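/- Let $K$ be a number field with algebraic closure $\overline K$, let $c\in K$, $c\neq 0$, and let $E_2$ be the elliptic curve $y^2=x^3+c$. Let $\zeta_3,\zeta_7\in\overline K$ be primitive roots of unity of orders $3$ and $7$, let $\phi_2$ be the map $(x,y)\mapsto(\zeta_3x,y)$ on $E_2(\overline K)$ (fixing the point at infinity), and let $K_7=K(E_2[7])$ be the field generated over $K$ by the coordinates of the affine points $P\in E_2(\overline K)$ with $7P=O$. Put \[ \begin{aligned} \delta_1&=-\big((-132\zeta_3-120)\zeta_7^5+(-168\zeta_3-12)\zeta_7^4+(-24\zeta_3+60)\zeta_7^3+(-60\zeta_3-84)\zeta_7^2+(-192\zeta_3-96)\zeta_7-96\zeta_3+52\big),\\ \delta_2&=-\big((-24\zeta_3-84)\zeta_7^5+(36\zeta_3-108)\zeta_7^4+(108\zeta_3-72)\zeta_7^3+(168\zeta_3+12)\zeta_7^2+(144\zeta_3+72)\zeta_7+72\zeta_3+64\big),\\ \delta_3&=-\big((108\zeta_3+180)\zeta_7^5+(-60\zeta_3+24)\zeta_7^4+(132\zeta_3+120)\zeta_7^3+(-36\zeta_3+108)\zeta_7^2+(72\zeta_3+36)\zeta_7+36\zeta_3+172\big),\\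 \delta_4&=-\big((132\zeta_3+12)\zeta_7^5+(168\zeta_3+156)\zeta_7^4+(24\zeta_3+84)\zeta_7^3+(60\zeta_3-24)\zeta_7^2+(192\zeta_3+96)\zeta_7+96\zeta_3+148\big),\\ \delta_5&=-\big((24\zeta_3-60)\zeta_7^5+(-36\zeta_3-144)\zeta_7^4+(-108\zeta_3-180)\zeta_7^3+(-168\zeta_3-156)\zeta_7^2+(-144\zeta_3-72)\zeta_7-72\zeta_3-8\big),\\ \delta_6&=-\big((-108\zeta_3+72)\zeta_7^5+(60\zeta_3+84)\zeta_7^4+(-132\zeta_3-12)\zeta_7^3+(36\zeta_3+144)\zeta_7^2+(-72\zeta_3-36)\zeta_7-36\zeta_3+136\big). \end{aligned} \] Let $1\le j\le 6$, and let $\sqrt[3]{\delta_jc}$ and $\sqrt{(\delta_j+1)c}$ be any cube root of $\delta_jc$ and any square root of $(\delta_j+1)c$ in $\overline K$. Then \[ K_7=K\big(\sqrt[3]{\delta_jc},\ \zeta_3,\ \sqrt{(\delta_j+1)c}\big)=K\big(\sqrt[3]{\delta_jc},\ \zeta_7,\ \sqrt{(\delta_j+1)c}\big). \] Moreover, $\sqrt[3]{\delta_jc}$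 is a root of the $7$-th division polynomial of $E_2$, and $P_j=\big(\sqrt[3]{\delta_jc},\sqrt{(\delta_j+1)c}\big)$ is a point of $E_2$ such that $P_j$ and $\phi_2(P_j)$ form a basis of $E_2[7]$ over $\mathbb Z/7\mathbb Z$; in particular they are independent. -/

import Mathlib

namespace DivisionField

open WeierstrassCurve

/-- The Weierstrass curve `y² = x³ + c`. -/
def curve {R : Type*} [CommRing R] (c : R) : WeierstrassCurve R where
  a₁ := 0
  a₂ := 0
  a₃ := 0
  a₄ := 0
  a₆ := c

/-- The group `W(L)` of `L`-rational points of a Weierstrass curve `W` over `K`. -/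
abbrev PointsOver {K : Type*} [Field K] (W : WeierstrassCurve K)
    (L : Type*) [Field L] [Algebra K L] : Type _ :=
  (W.baseChange L).toAffine.Point

/-- The set of the coordinates of the affine `m`-torsion points of `W(L)`. -/
def torsionCoordinates {K : Type*} [Field K] (W : WeierstrassCurve K)
    (L : Type*) [Field L] [DecidableEq L] [Algebra K L] (m : ℕ) : Set L :=
  {t | ∃ (x y : L) (h : (W.baseChange L).toAffine.Nonsingular x y),
    m • (Affine.Point.some x y h : PointsOver W L) = 0 ∧ (t = x ∨ t = y)}

/-- The `m`-th division field `K(W[m])`, as a subfield of `L` (an algebraic closure of `K`). -/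
def divisionField {K : Type*} [Field K] (W : WeierstrassCurve K)
    (L : Type*) [Field L] [DecidableEq L] [Algebra K L] (m : ℕ) : IntermediateField K L :=
  IntermediateField.adjoin K (torsionCoordinates W L m)

/-- The elements `δ₁, …, δ₆`, in this order (`delta a b 0` is `δ₁`), for `a = ζ₃` and `b = ζ₇`. -/
def delta {R : Type*} [CommRing R] (a b : R) : Fin 6 → R :=
  ![-((-132 * a - 120) * b ^ 5 + (-168 * a - 12) * b ^ 4 + (-24 * a + 60) * b ^ 3
        + (-60 * a - 84) * b ^ 2 + (-192 * a - 96) * b - 96 * a + 52),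
    -((-24 * a - 84) * b ^ 5 + (36 * a - 108) * b ^ 4 + (108 * a - 72) * b ^ 3
        + (168 * a + 12) * b ^ 2 + (144 * a + 72) * b + 72 * a + 64),
    -((108 * a + 180) * b ^ 5 + (-60 * a + 24) * b ^ 4 + (132 * a + 120) * b ^ 3
        + (-36 * a + 108) * b ^ 2 + (72 * a + 36) * b + 36 * a + 172),
    -((132 * a + 12) * b ^ 5 + (168 * a + 156) * b ^ 4 + (24 * a + 84) * b ^ 3
        + (60 * a - 24) * b ^ 2 + (192 * a + 96) * b + 96 * a + 148),
    -((24 * a - 60) * b ^ 5 + (-36 * a - 144) * b ^ 4 + (-108 * a - 180) * b ^ 3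
        + (-168 * a - 156) * b ^ 2 + (-144 * a - 72) * b - 72 * a - 8),
    -((-108 * a + 72) * b ^ 5 + (60 * a + 84) * b ^ 4 + (-132 * a - 12) * b ^ 3
        + (36 * a + 144) * b ^ 2 + (-72 * a - 36) * b - 36 * a + 136)]

/-- If `ω³ = 1` and `(x, y)` is a nonsingular point of `y² = x³ + c`, then so is `(ω x, y)`. -/
theorem nonsingular_mul {K L : Type*} [Field K] [Field L] [Algebra K L] {c : K} {ω : L}
    (hω : ω ^ 3 = 1) {x y : L}
    (h : ((curve c).baseChange L).toAffine.Nonsingular x y) :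
    ((curve c).baseChange L).toAffine.Nonsingular (ω * x) y := by
  have h0 : ω ≠ 0 := by
    rintro rfl
    norm_num at hω
  rw [Affine.nonsingular_iff, Affine.equation_iff] at h ⊢
  simp only [curve, WeierstrassCurve.baseChange, WeierstrassCurve.map_a₁,
    WeierstrassCurve.map_a₂, WeierstrassCurve.map_a₃, WeierstrassCurve.map_a₄,
    WeierstrassCurve.map_a₆, map_zero, zero_mul, add_zero, mul_zero, sub_zero] at h ⊢
  refine ⟨?_, ?_⟩
  · rw [h.1, mul_pow, hω, one_mul]
  · rcases h.2 with h2 | h2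
    · left
      intro h3
      apply h2
      have h4 : ω ^ 2 * (3 * x ^ 2) = 0 := by linear_combination -h3
      rcases mul_eq_zero.1 h4 with h5 | h5
      · exact absurd h5 (pow_ne_zero 2 h0)
      · exact h5.symm
    · exact Or.inr h2

/-- The map `(x, y) ↦ (ω x, y)` on the points of `y² = x³ + c`, for `ω³ = 1`, fixing the point at
infinity: for `ω = ζ₃` it is the complex multiplication by `ζ₃`. -/
def cm {K L : Type*} [Field K] [Field L] [Algebra K L] (c : K) (ω : L) (hω : ω ^ 3 = 1) :
    PointsOver (curve c) L → PointsOver (curve c) L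
  | Affine.Point.zero => Affine.Point.zero
  | Affine.Point.some x y h => Affine.Point.some (ω * x) y (nonsingular_mul hω h)

end DivisionField

/-!
Let `P = (x, y)` with `x³ = δ₁ c`, where `δ₁ = δ₁(ζ₃, ζ₇)`. The duplication formula multiplies
`x` and `y` by elements `u` and `v` of `ℤ[ζ₃, ζ₇]`, and `δ₁(ζ₃, ζ₇) u³ = δ₁(ζ₃, ζ₇⁴)`: doubling
conjugates `ζ₇` to `ζ₇⁴`. As `4` has order `3` modulo `7`, and `u` and `v` have norm `1` along this
orbit, `8P = P`.

Conversely `δ₁` determines `u`, hence also the conjugate of `u` under `ζ₇ ↦ ζ₇⁴`, and `ζ₇²` is a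
polynomial in `ζ₃` and these two. So `ζ₇ ∈ K(ζ₃, δ₁)`, and the values of `δ₁` at the conjugates of
`ζ₇` are distinct. If `φ₂(P)` were a multiple of `P`, it would be `±2ⁿP` with `n < 3`, and comparing
cubes of abscissas would give `ζ₇ ^ 4ⁿ = ζ₇`, so `n = 0` and `ζ₃ = 1`. The other `δⱼ` are the values
of `δ₁` at the other conjugates of `ζ₇`.

That `P` and `φ₂(P)` span the `7`-torsion follows by counting: `3T = -4T` makes the abscissa of a
`7`-torsion point `T` a root of the division polynomial, which has degree `24`, so there are at most
`49` such points.
-/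

namespace DivisionField

open WeierstrassCurve

section AbelianGroups

variable {G : Type*} [AddCommGroup G] {P Q : G}

theorem dvd_and_dvd_of_zsmul_add_zsmul_eq_zero {p : ℕ} [hp : Fact p.Prime] (hP : p • P = 0)
    (hQ : p • Q = 0) (hP0 : P ≠ 0) (hPQ : ∀ k : ℤ, Q ≠ k • P) {a b : ℤ}
    (h : a • P + b • Q = 0) : (p : ℤ) ∣ a ∧ (p : ℤ) ∣ b := by
  have hQ' : (p : ℤ) • Q = 0 := by rw [natCast_zsmul, hQ]
  have hb : (p : ℤ) ∣ b := by
    by_contra hb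
    obtain ⟨u, v, huv⟩ := ((Nat.prime_iff_prime_int.1 hp.out).coprime_iff_not_dvd.2 hb).symm
    refine hPQ (-(u * a)) ?_
    calc Q = (u * b + v * p) • Q := by rw [huv, one_zsmul]
      _ = u • (a • P + b • Q) - (u * a) • P + v • (p : ℤ) • Q := by module
      _ = -(u * a) • P := by rw [h, hQ']; module
  obtain ⟨m, rfl⟩ := hb
  have ha : a • P = 0 := by
    rwa [mul_comm, mul_zsmul, hQ', zsmul_zero, add_zero] at h
  exact ⟨addOrderOf_eq_prime hP hP0 ▸ addOrderOf_dvd_iff_zsmul_eq_zero.2 ha, dvd_mul_right ..⟩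

theorem exists_eq_zsmul_add_zsmul_of_encard_le {p : ℕ} (hP : p • P = 0)
    (hQ : p • Q = 0) (hPQ : ∀ a b : ℤ, a • P + b • Q = 0 → (p : ℤ) ∣ a ∧ (p : ℤ) ∣ b)
    (hcard : {T : G | p • T = 0}.encard ≤ p ^ 2) {T : G} (hT : p • T = 0) :
    ∃ a b : ℤ, T = a • P + b • Q := by
  let f : Fin p × Fin p → G := fun i ↦ (i.1 : ℤ) • P + (i.2 : ℤ) • Q
  have hf : Function.Injective f := by
    rintro ⟨i, j⟩ ⟨i', j'⟩ h
    have hdvd := hPQ ((i : ℤ) - i') ((j : ℤ) - j') <| by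
      rw [← sub_eq_zero.2 h]
      module
    have eq_of_dvd {m n : Fin p} (h : (p : ℤ) ∣ (m : ℤ) - n) : m = n := by
      have := Int.eq_zero_of_abs_lt_dvd h (by rw [abs_lt]; omega)
      omega
    rw [eq_of_dvd hdvd.1, eq_of_dvd hdvd.2]
  have hsub : Set.range f ⊆ {T : G | p • T = 0} := by
    rintro _ ⟨i, rfl⟩
    calc p • ((i.1 : ℤ) • P + (i.2 : ℤ) • Q) = (i.1 : ℤ) • p • P + (i.2 : ℤ) • p • Q := by module
      _ = 0 := by rw [hP, hQ, smul_zero, smul_zero, add_zero]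
  have hrange : (Set.range f).encard = p ^ 2 := by
    rw [← Set.image_univ, hf.encard_image, Set.encard_univ, ENat.card_eq_coe_fintype_card,
      Fintype.card_prod, Fintype.card_fin, ← sq, Nat.cast_pow]
  have heq := (Set.finite_range f).eq_of_subset_of_encard_le hsub (hcard.trans hrange.ge)
  obtain ⟨i, hi⟩ : T ∈ Set.range f := heq ▸ hT
  exact ⟨i.1, i.2, hi.symm⟩

theorem zsmul_eq_zero_or_eq_two_pow_nsmul_or_eq_neg (hP : 7 • P = 0) (k : ℤ) :
    k • P = 0 ∨ ∃ n < 3, k • P = 2 ^ n • P ∨ k • P = -(2 ^ n • P) := by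
  have zsmul_eq {r : ℤ} (h : 7 ∣ k - r) : k • P = r • P := by
    obtain ⟨m, hm⟩ := h
    calc k • P = m • 7 • P + r • P := by rw [eq_add_of_sub_eq hm]; module
      _ = r • P := by rw [hP, smul_zero, zero_add]
  have hmod : 7 ∣ k - 0 ∨ ∃ n < 3, 7 ∣ k - 2 ^ n ∨ 7 ∣ k - -2 ^ n := by
    simp only [Nat.exists_lt_succ_right, Nat.not_lt_zero, false_and, exists_false]
    omega
  refine hmod.imp (fun h ↦ by rw [zsmul_eq h, zero_zsmul]) ?_
  rintro ⟨n, hn, h | h⟩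
  · exact ⟨n, hn, .inl (by rw [zsmul_eq h]; norm_cast)⟩
  · exact ⟨n, hn, .inr (by rw [zsmul_eq h, neg_zsmul]; norm_cast)⟩

end AbelianGroups

section WeierstrassCurves

theorem encard_le_of_forall_X_mem {F : Type*} [Field F] {W : Affine F} {S : Set W.Point}
    {s : Finset F} (hS : ∀ x y h, Affine.Point.some x y h ∈ S → x ∈ s) :
    S.encard ≤ 2 * s.card + 1 := by
  let fiber (x : F) : Set W.Point := {P | P.xRep = ![x, 1]}
  have hfiber (x : F) : (fiber x).encard ≤ 2 := by
    obtain h | ⟨P, hP⟩ := (fiber x).eq_empty_or_nonempty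
    · simp [h]
    · refine (Set.encard_le_encard (t := {P, -P}) ?_).trans
        ((Set.encard_insert_le _ _).trans_eq (by rw [Set.encard_singleton, one_add_one_eq_two]))
      exact fun Q hQ ↦ Affine.Point.xRep_eq_xRep_iff.1 (hQ.trans hP.symm)
  have hsub : S ⊆ insert 0 (⋃ x ∈ s, fiber x) := by
    rintro (_ | ⟨x, y, h⟩) hP
    · exact .inl rfl
    · exact .inr (Set.mem_biUnion (hS x y h hP) rfl)
  calc S.encard ≤ (⋃ x ∈ s, fiber x).encard + 1 :=
        (Set.encard_le_encard hsub).trans (Set.encard_insert_le _ _)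
    _ ≤ (∑ x ∈ s, (fiber x).encard) + 1 := by gcongr; exact s.set_encard_biUnion_le fiber
    _ ≤ 2 * s.card + 1 := by
        gcongr
        exact (Finset.sum_le_card_nsmul s _ 2 fun x _ ↦ hfiber x).trans_eq (by simp [mul_comm])

variable {K L : Type*} [Field K] [Field L] [DecidableEq L] [Algebra K L] {W : WeierstrassCurve K}

theorem some_mem_range_map_val_iff {F : IntermediateField K L} {x y : L}
    {h : (W.baseChange L).toAffine.Nonsingular x y} :
    (Affine.Point.some x y h : PointsOver W L) ∈ (Affine.Point.map (W' := W) F.val).range ↔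
      x ∈ F ∧ y ∈ F := by
  constructor
  · rintro ⟨_ | ⟨u, v, huv⟩, hT⟩
    · exact (Affine.Point.some_ne_zero h hT.symm).elim
    · obtain ⟨rfl, rfl⟩ := Affine.Point.some.inj hT
      exact ⟨u.2, v.2⟩
  · rintro ⟨hx, hy⟩
    exact ⟨.some ⟨x, hx⟩ ⟨y, hy⟩ ((Affine.baseChange_nonsingular W F.val.injective ..).1 h), rfl⟩

theorem divisionField_le_iff {F : IntermediateField K L} {m : ℕ} :
    divisionField W L m ≤ F ↔
      ∀ T : PointsOver W L, m • T = 0 → T ∈ (Affine.Point.map (W' := W) F.val).range := by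
  rw [divisionField, IntermediateField.adjoin_le_iff]
  constructor
  · rintro hF (_ | ⟨x, y, h⟩) hT
    · exact zero_mem _
    · exact some_mem_range_map_val_iff.2 ⟨hF ⟨x, y, h, hT, .inl rfl⟩, hF ⟨x, y, h, hT, .inr rfl⟩⟩
  · rintro hF t ⟨x, y, h, hT, rfl | rfl⟩
    · exact (some_mem_range_map_val_iff.1 (hF _ hT)).1
    · exact (some_mem_range_map_val_iff.1 (hF _ hT)).2

theorem X_mem_and_Y_mem_divisionField {m : ℕ} {x y : L}
    {h : (W.baseChange L).toAffine.Nonsingular x y}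
    (hm : m • (Affine.Point.some x y h : PointsOver W L) = 0) :
    x ∈ divisionField W L m ∧ y ∈ divisionField W L m :=
  some_mem_range_map_val_iff.1 (divisionField_le_iff.1 le_rfl _ hm)

end WeierstrassCurves

section Curve

variable {K L : Type*} [Field K] [Field L] [Algebra K L] {c : K} {x y : L}

theorem equation_curve_iff :
    ((curve c).baseChange L).toAffine.Equation x y ↔ y ^ 2 = x ^ 3 + algebraMap K L c := by
  rw [Affine.equation_iff]
  simp [curve, WeierstrassCurve.baseChange]

theorem negY_curve : ((curve c).baseChange L).toAffine.negY x y = -y := by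
  simp [Affine.negY, curve, WeierstrassCurve.baseChange]

theorem addX_curve {x₁ x₂ l : L} :
    ((curve c).baseChange L).toAffine.addX x₁ x₂ l = l ^ 2 - x₁ - x₂ := by
  simp [Affine.addX, curve, WeierstrassCurve.baseChange]

theorem eval_preΨ'_seven_curve (x : L) :
    (((curve c).baseChange L).preΨ' 7).eval x =
      7 * x ^ 24 + 3944 * algebraMap K L c * x ^ 21 - 42896 * algebraMap K L c ^ 2 * x ^ 18
        - 829696 * algebraMap K L c ^ 3 * x ^ 15 - 928256 * algebraMap K L c ^ 4 * x ^ 12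
        - 1555456 * algebraMap K L c ^ 5 * x ^ 9 - 2809856 * algebraMap K L c ^ 6 * x ^ 6
        - 802816 * algebraMap K L c ^ 7 * x ^ 3 + 65536 * algebraMap K L c ^ 8 := by
  have h5 := ((curve c).baseChange L).preΨ'_odd 0
  have h7 := ((curve c).baseChange L).preΨ'_odd 1
  norm_num at h5 h7
  rw [h7, h5]
  simp [Ψ₃, preΨ₄, Ψ₂Sq, WeierstrassCurve.b₂, WeierstrassCurve.b₄, WeierstrassCurve.b₆,
    WeierstrassCurve.b₈, curve, WeierstrassCurve.baseChange]
  ring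

theorem nonsingular_curve_of_Y_ne_zero [NeZero (2 : L)] (hE : y ^ 2 = x ^ 3 + algebraMap K L c)
    (hy : y ≠ 0) : ((curve c).baseChange L).toAffine.Nonsingular x y := by
  refine (Affine.nonsingular_iff ..).2 ⟨equation_curve_iff.2 hE, .inr ?_⟩
  have hneg : y ≠ -y := fun h ↦ mul_ne_zero two_ne_zero hy (by linear_combination h)
  simpa [curve, WeierstrassCurve.baseChange] using hneg

section Addition

variable [DecidableEq L]

theorem exists_add_eq_some_of_X_ne {x₁ y₁ x₂ y₂ : L}
    (h₁ : ((curve c).baseChange L).toAffine.Nonsingular x₁ y₁)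
    (h₂ : ((curve c).baseChange L).toAffine.Nonsingular x₂ y₂) (hx : x₁ ≠ x₂) :
    ∃ x₃ y₃ h₃, (.some x₁ y₁ h₁ + .some x₂ y₂ h₂ : PointsOver (curve c) L) = .some x₃ y₃ h₃ ∧
      (x₁ - x₂) ^ 2 * x₃ = (y₁ - y₂) ^ 2 - (x₁ - x₂) ^ 2 * (x₁ + x₂) := by
  refine ⟨_, _, _, Affine.Point.add_of_X_ne hx, ?_⟩
  have hx' : x₁ - x₂ ≠ 0 := sub_ne_zero.2 hx
  rw [Affine.slope_of_X_ne hx, addX_curve]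
  field

variable [NeZero (2 : L)]

theorem exists_two_nsmul_eq_some (h : ((curve c).baseChange L).toAffine.Nonsingular x y)
    (hy : y ≠ 0) :
    ∃ x₂ y₂ h₂, (2 • .some x y h : PointsOver (curve c) L) = .some x₂ y₂ h₂ ∧
      4 * y ^ 2 * x₂ = x ^ 4 - 8 * algebraMap K L c * x ∧
      8 * y ^ 3 * y₂ = x ^ 6 + 20 * algebraMap K L c * x ^ 3 - 8 * algebraMap K L c ^ 2 := by
  have h2y : 2 * y ≠ 0 := mul_ne_zero two_ne_zero hy
  have hE : y ^ 2 = x ^ 3 + algebraMap K L c := equation_curve_iff.1 h.1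
  have hneg : y ≠ ((curve c).baseChange L).toAffine.negY x y := by
    rw [negY_curve]
    exact fun h ↦ h2y (by linear_combination h)
  have hslope : ((curve c).baseChange L).toAffine.slope x x y y = 3 * x ^ 2 / (2 * y) := by
    rw [Affine.slope_of_Y_ne rfl hneg, negY_curve, sub_neg_eq_add, ← two_mul]
    simp [curve, WeierstrassCurve.baseChange]
  have hX : 4 * y ^ 2 * ((curve c).baseChange L).toAffine.addX x x (3 * x ^ 2 / (2 * y)) =
      x ^ 4 - 8 * algebraMap K L c * x := by
    rw [addX_curve]
    field_simp
    linear_combination -32 * x * hE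
  refine ⟨_, _, _, (two_nsmul _).trans (Affine.Point.add_self_of_Y_ne hneg), ?_, ?_⟩
  · rw [hslope, hX]
  · rw [hslope, Affine.addY, Affine.negAddY, negY_curve]
    generalize ((curve c).baseChange L).toAffine.addX x x (3 * x ^ 2 / (2 * y)) = x₂ at hX ⊢
    field_simp
    linear_combination -6 * x ^ 2 * hX + (8 * x ^ 3 - 16 * y ^ 2 - 16 * algebraMap K L c) * hE

theorem exists_three_nsmul_eq_some (h : ((curve c).baseChange L).toAffine.Nonsingular x y)
    (hy : y ≠ 0) (h3 : (3 • .some x y h : PointsOver (curve c) L) ≠ 0) :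
    ∃ x₃ y₃ h₃, (3 • .some x y h : PointsOver (curve c) L) = .some x₃ y₃ h₃ ∧
      (3 * x ^ 4 + 12 * algebraMap K L c * x) ^ 2 * x₃ = x ^ 9 - 96 * algebraMap K L c * x ^ 6 +
        48 * algebraMap K L c ^ 2 * x ^ 3 + 64 * algebraMap K L c ^ 3 := by
  obtain ⟨x₂, y₂, h₂, hdouble, hx₂, hy₂⟩ := exists_two_nsmul_eq_some h hy
  have hne : x₂ ≠ x := by
    intro hx
    obtain h' | h' := (Affine.Point.X_eq_iff (h₁ := h₂) (h₂ := h)).1 hx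
    · rw [← hdouble, two_nsmul, add_eq_left] at h'
      exact Affine.Point.some_ne_zero h h'
    · rw [← hdouble, eq_neg_iff_add_eq_zero, ← succ_nsmul] at h'
      exact h3 h'
  obtain ⟨x₃, y₃, h₃, hadd, hx₃⟩ := exists_add_eq_some_of_X_ne h₂ h hne
  refine ⟨x₃, y₃, h₃, by rw [succ_nsmul, hdouble, hadd], ?_⟩
  have hE : y ^ 2 = x ^ 3 + algebraMap K L c := equation_curve_iff.1 h.1
  have hpsi : 4 * y ^ 2 * (x₂ - x) = -(3 * x ^ 4 + 12 * algebraMap K L c * x) := by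
    linear_combination hx₂ - 4 * x * hE
  have h4y : (2 * y) ^ 2 ≠ 0 := pow_ne_zero 2 (mul_ne_zero two_ne_zero hy)
  refine mul_left_cancel₀ h4y ?_
  calc (2 * y) ^ 2 * ((3 * x ^ 4 + 12 * algebraMap K L c * x) ^ 2 * x₃)
      = (2 * y) ^ 2 * ((4 * y ^ 2 * (x₂ - x)) ^ 2 * x₃) := by rw [hpsi, neg_sq]
    _ = (8 * y ^ 3 * y₂ - 8 * (y ^ 2) ^ 2) ^ 2 -
          (4 * y ^ 2 * x₂ + 4 * y ^ 2 * x) * (4 * y ^ 2 * (x₂ - x)) ^ 2 := by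
      linear_combination 64 * y ^ 6 * hx₃
    _ = _ := by
      rw [hpsi, hx₂, hy₂, mul_pow 2 y, hE]
      ring

end Addition

section SevenTorsion

variable [DecidableEq L]

theorem Y_ne_zero_of_two_nsmul_ne_zero {h : ((curve c).baseChange L).toAffine.Nonsingular x y}
    (h2 : (2 • .some x y h : PointsOver (curve c) L) ≠ 0) : y ≠ 0 := by
  rintro rfl
  exact h2 ((two_nsmul _).trans (Affine.Point.add_self_of_Y_eq (by rw [negY_curve, neg_zero])))

variable [NeZero (2 : L)]

theorem eval_preΨ'_seven_eq_zero {h : ((curve c).baseChange L).toAffine.Nonsingular x y}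
    (h7 : (7 • .some x y h : PointsOver (curve c) L) = 0) :
    (((curve c).baseChange L).preΨ' 7).eval x = 0 := by
  have : Fact (Nat.Prime 7) := ⟨by norm_num⟩
  have horder := addOrderOf_eq_prime h7 (Affine.Point.some_ne_zero h)
  have nsmul_ne_zero {n : ℕ} (hn : ¬7 ∣ n) : (n • .some x y h : PointsOver (curve c) L) ≠ 0 :=
    fun h0 ↦ hn (horder ▸ addOrderOf_dvd_of_nsmul_eq_zero h0)
  have hy : y ≠ 0 := Y_ne_zero_of_two_nsmul_ne_zero (nsmul_ne_zero (by norm_num))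
  obtain ⟨x₂, y₂, h₂, hdouble, hx₂, hy₂⟩ := exists_two_nsmul_eq_some h hy
  have hy₂' : y₂ ≠ 0 := Y_ne_zero_of_two_nsmul_ne_zero (h := h₂) <| by
    rw [← hdouble, ← mul_nsmul]
    exact nsmul_ne_zero (by norm_num)
  obtain ⟨x₄, y₄, h₄, hquad, hx₄, -⟩ := exists_two_nsmul_eq_some h₂ hy₂'
  obtain ⟨x₃, y₃, h₃, htriple, hx₃⟩ :=
    exists_three_nsmul_eq_some h hy (nsmul_ne_zero (by norm_num))
  have hx₃₄ : x₃ = x₄ := by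
    refine (Affine.Point.X_eq_iff (h₁ := h₃) (h₂ := h₄)).2 (.inr (eq_neg_of_add_eq_zero_left ?_))
    rw [← htriple, ← hquad, ← hdouble, ← mul_nsmul, ← add_nsmul, h7]
  have hE : y ^ 2 = x ^ 3 + algebraMap K L c := equation_curve_iff.1 h.1
  rw [eval_preΨ'_seven_curve]
  set C := algebraMap K L c
  have hx₄' : 16 * (x ^ 3 + C) * (x ^ 6 + 20 * C * x ^ 3 - 8 * C ^ 2) ^ 2 * x₄ =
      (x ^ 4 - 8 * C * x) ^ 4 - 512 * C * (x ^ 4 - 8 * C * x) * (x ^ 3 + C) ^ 3 := by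
    rw [← hx₂, ← hy₂, ← hE]
    linear_combination 256 * y ^ 8 * hx₄
  linear_combination (3 * x ^ 4 + 12 * C * x) ^ 2 * (hx₄' +
    16 * (x ^ 3 + C) * (x ^ 6 + 20 * C * x ^ 3 - 8 * C ^ 2) ^ 2 * hx₃₄) -
    16 * (x ^ 3 + C) * (x ^ 6 + 20 * C * x ^ 3 - 8 * C ^ 2) ^ 2 * hx₃

theorem encard_seven_torsion_le (h7 : (7 : L) ≠ 0) :
    {T : PointsOver (curve c) L | 7 • T = 0}.encard ≤ (7 : ℕ) ^ 2 := by
  let W := (curve c).baseChange L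
  have hcard : (W.preΨ' 7).roots.toFinset.card ≤ 24 :=
    calc (W.preΨ' 7).roots.toFinset.card ≤ (W.preΨ' 7).natDegree :=
          (Multiset.toFinset_card_le _).trans (Polynomial.card_roots' _)
      _ ≤ 24 := W.natDegree_preΨ'_le 7
  calc {T : PointsOver (curve c) L | 7 • T = 0}.encard
      ≤ 2 * (W.preΨ' 7).roots.toFinset.card + 1 := encard_le_of_forall_X_mem fun x y h hT ↦ by
        rw [Multiset.mem_toFinset, Polynomial.mem_roots (W.preΨ'_ne_zero (mod_cast h7))]
        exact eval_preΨ'_seven_eq_zero hT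
    _ ≤ (7 : ℕ) ^ 2 := by norm_cast; omega

end SevenTorsion

end Curve

section Delta

variable {R : Type*} [CommRing R] {a b : R}

/-- The ratio of the abscissas of `2P` and `P`, where `P = (x, y)` lies on `y² = x³ + c` and
`x³ = δ₁ c`. -/
def xRatio (a b : R) : R :=
  a * b ^ 5 - 2 * a * b ^ 4 + 2 * a * b ^ 3 - a * b ^ 2 + 2 * b ^ 5 - b ^ 4 + b ^ 3 + b ^ 2 + 1

/-- The ratio of the ordinates of `2P` and `P`, where `P = (x, y)` lies on `y² = x³ + c` and
`x³ = δ₁ c`. -/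
def yRatio (a b : R) : R :=
  -10 * a * b ^ 5 + 2 * a * b ^ 4 - 10 * a * b ^ 3 + 2 * a * b ^ 2 - 8 * a * b - 4 * a
    - 14 * b ^ 5 - 4 * b ^ 4 - 10 * b ^ 3 - 8 * b ^ 2 - 4 * b - 15

theorem exists_coprime_delta_eq (hb : 1 + b + b ^ 2 + b ^ 3 + b ^ 4 + b ^ 5 + b ^ 6 = 0)
    (j : Fin 6) : ∃ n : ℕ, n.Coprime 7 ∧ delta a b j = delta a (b ^ n) 0 := by
  refine ⟨![1, 5, 4, 6, 2, 3] j, by decide +revert, ?_⟩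
  fin_cases j <;> simp [delta] <;> grind

-- `xRatio a b` is affine in `a`, and the last factor times its slope `b⁵ - 2b⁴ + 2b³ - b²` is `7`.
theorem seven_mul_root_three_eq (hb : 1 + b + b ^ 2 + b ^ 3 + b ^ 4 + b ^ 5 + b ^ 6 = 0) :
    7 * a = (xRatio a b - (2 * b ^ 5 - b ^ 4 + b ^ 3 + b ^ 2 + 1)) *
      (8 + 16 * b + 17 * b ^ 2 + 11 * b ^ 3 + 5 * b ^ 4 - b ^ 5) := by
  simp only [xRatio]
  grind

variable (ha : 1 + a + a ^ 2 = 0) (hb : 1 + b + b ^ 2 + b ^ 3 + b ^ 4 + b ^ 5 + b ^ 6 = 0)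

include ha hb

theorem four_mul_delta_add_one_mul_xRatio :
    4 * (delta a b 0 + 1) * xRatio a b = delta a b 0 - 8 := by
  simp only [delta, Matrix.cons_val_zero, xRatio]
  grind

theorem eight_mul_delta_add_one_sq_mul_yRatio :
    8 * (delta a b 0 + 1) ^ 2 * yRatio a b = delta a b 0 ^ 2 + 20 * delta a b 0 - 8 := by
  simp only [delta, Matrix.cons_val_zero, yRatio]
  grind

theorem delta_pow_four : delta a (b ^ 4) 0 = delta a b 0 * xRatio a b ^ 3 := by
  simp only [delta, Matrix.cons_val_zero, xRatio]
  grind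

theorem prod_xRatio : ∏ k ∈ Finset.range 3, xRatio a (b ^ 4 ^ k) = 1 := by
  have hb16 : b ^ 16 = b ^ 2 := by grind
  simp only [Finset.prod_range_succ, Finset.prod_range_zero, xRatio]
  norm_num [hb16]
  grind

theorem prod_yRatio : ∏ k ∈ Finset.range 3, yRatio a (b ^ 4 ^ k) = 1 := by
  have hb16 : b ^ 16 = b ^ 2 := by grind
  simp only [Finset.prod_range_succ, Finset.prod_range_zero, yRatio]
  norm_num [hb16]
  grind

-- With `u = xRatio a b` and `w = xRatio a (b ^ 4)`, the elements `1, u, w, u w, u², w²` form a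
-- basis of `ℚ(ζ₃, ζ₇)` over `ℚ(ζ₃)`; these are the coordinates of `b²`, up to denominators.
theorem mul_root_seven_sq_eq :
    189 * b ^ 2 = -210 - 114 * a - 27 * a * xRatio a b + (48 * a - 21) * xRatio a (b ^ 4) +
      (8 * a + 7) * xRatio a b * (xRatio a b + xRatio a (b ^ 4)) +
      (7 - a) * xRatio a (b ^ 4) ^ 2 := by
  simp only [xRatio]
  grind

end Delta

section PrimitiveRoots

variable {L : Type*} [Field L] {a b : L}

theorem one_add_add_sq_eq_zero (ha : IsPrimitiveRoot a 3) : 1 + a + a ^ 2 = 0 := by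
  simpa [Finset.sum_range_succ] using ha.geom_sum_eq_zero (by norm_num)

theorem sum_pow_eq_zero (hb : IsPrimitiveRoot b 7) :
    1 + b + b ^ 2 + b ^ 3 + b ^ 4 + b ^ 5 + b ^ 6 = 0 := by
  simpa [Finset.sum_range_succ] using hb.geom_sum_eq_zero (by norm_num)

theorem isPrimitiveRoot_pow_four_pow (hb : IsPrimitiveRoot b 7) (n : ℕ) :
    IsPrimitiveRoot (b ^ 4 ^ n) 7 :=
  hb.pow_of_coprime _ (.pow_left n (by norm_num))

theorem eq_zero_of_pow_four_pow_eq (hb : IsPrimitiveRoot b 7) {n : ℕ} (hn : n < 3)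
    (h : b ^ 4 ^ n = b) : n = 0 := by
  have hmod : 4 ^ n % 7 = 1 % 7 := by
    rwa [hb.eq_orderOf, ← (hb.isOfFinOrder (by norm_num)).pow_inj_mod, pow_one]
  interval_cases n <;> simp_all

theorem pow_mem_iff_mem {S : Type*} [SetLike S L] [SubmonoidClass S L] {F : S}
    {m n : ℕ} [NeZero m] (hb : IsPrimitiveRoot b m) (hn : n.Coprime m) : b ^ n ∈ F ↔ b ∈ F := by
  refine ⟨fun h ↦ ?_, (pow_mem · n)⟩
  obtain ⟨i, -, hi⟩ := (hb.pow_of_coprime n hn).eq_pow_of_pow_eq_one hb.pow_eq_one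
  exact hi ▸ pow_mem h i

variable (ha : IsPrimitiveRoot a 3) (hb : IsPrimitiveRoot b 7)

include ha hb

theorem delta_pow_four_pow (n : ℕ) :
    delta a (b ^ 4 ^ n) 0 = delta a b 0 * (∏ k ∈ Finset.range n, xRatio a (b ^ 4 ^ k)) ^ 3 := by
  induction n with
  | zero => simp
  | succ n ih =>
    rw [pow_succ 4, pow_mul, delta_pow_four (one_add_add_sq_eq_zero ha)
      (sum_pow_eq_zero (isPrimitiveRoot_pow_four_pow hb n)), ih, Finset.prod_range_succ]
    ring

theorem delta_add_one_ne_zero : delta a b 0 + 1 ≠ 0 := by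
  intro h
  have h3 : (3 : L) ≠ 0 := (ha.neZero' (n := 3)).out
  have h9 := four_mul_delta_add_one_mul_xRatio (one_add_add_sq_eq_zero ha) (sum_pow_eq_zero hb)
  exact mul_ne_zero h3 h3 (by linear_combination (1 - 4 * xRatio a b) * h + h9)

theorem root_seven_sq_eq_div : b ^ 2 =
    (-210 - 114 * a - 27 * a * xRatio a b + (48 * a - 21) * xRatio a (b ^ 4) +
      (8 * a + 7) * xRatio a b * (xRatio a b + xRatio a (b ^ 4)) +
      (7 - a) * xRatio a (b ^ 4) ^ 2) / 189 := by
  have h3 : (3 : L) ≠ 0 := (ha.neZero' (n := 3)).out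
  have h7 : (7 : L) ≠ 0 := (hb.neZero' (n := 7)).out
  have h189 : (189 : L) ≠ 0 := by
    simpa only [(by norm_num : (189 : L) = 3 ^ 3 * 7)] using mul_ne_zero (pow_ne_zero 3 h3) h7
  rw [eq_div_iff h189, mul_comm,
    mul_root_seven_sq_eq (one_add_add_sq_eq_zero ha) (sum_pow_eq_zero hb)]

variable [NeZero (2 : L)]

theorem xRatio_eq : xRatio a b = (delta a b 0 - 8) / (4 * (delta a b 0 + 1)) := by
  have h4 : (4 : L) ≠ 0 := by
    rw [← two_add_two_eq_four, ← two_mul]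
    exact mul_ne_zero two_ne_zero two_ne_zero
  rw [eq_div_iff (mul_ne_zero h4 (delta_add_one_ne_zero ha hb)), mul_comm,
    four_mul_delta_add_one_mul_xRatio (one_add_add_sq_eq_zero ha) (sum_pow_eq_zero hb)]

theorem eq_of_delta_eq {b' : L} (hb' : IsPrimitiveRoot b' 7) (h : delta a b 0 = delta a b' 0) :
    b = b' := by
  have xRatio_eq_of_delta_eq {z z' : L} (hz : IsPrimitiveRoot z 7) (hz' : IsPrimitiveRoot z' 7)
      (h : delta a z 0 = delta a z' 0) : xRatio a z = xRatio a z' := by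
    rw [xRatio_eq ha hz, xRatio_eq ha hz', h]
  have hu : xRatio a b = xRatio a b' := xRatio_eq_of_delta_eq hb hb' h
  have hu₄ : xRatio a (b ^ 4) = xRatio a (b' ^ 4) := by
    refine xRatio_eq_of_delta_eq (hb.pow_of_coprime 4 (by norm_num))
      (hb'.pow_of_coprime 4 (by norm_num)) ?_
    rw [delta_pow_four (one_add_add_sq_eq_zero ha) (sum_pow_eq_zero hb),
      delta_pow_four (one_add_add_sq_eq_zero ha) (sum_pow_eq_zero hb'), h, hu]
  have hsq : b ^ 2 = b' ^ 2 := by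
    rw [root_seven_sq_eq_div ha hb, root_seven_sq_eq_div ha hb', hu, hu₄]
  calc b = (b ^ 2) ^ 4 := by rw [← pow_mul, pow_succ b 7, hb.pow_eq_one, one_mul]
    _ = b' := by rw [hsq, ← pow_mul, pow_succ b' 7, hb'.pow_eq_one, one_mul]

theorem delta_ne_zero : delta a b 0 ≠ 0 := by
  intro h
  have h₄ : delta a (b ^ 4) 0 = 0 := by
    rw [delta_pow_four (one_add_add_sq_eq_zero ha) (sum_pow_eq_zero hb), h, zero_mul]
  have hpow : b ^ 4 = b :=
    eq_of_delta_eq ha (hb.pow_of_coprime 4 (by norm_num)) hb (h₄.trans h.symm)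
  exact one_ne_zero (eq_zero_of_pow_four_pow_eq hb (n := 1) (by norm_num) hpow)

section Subfields

variable {S : Type*} [SetLike S L] [SubfieldClass S L] {F : S}

theorem xRatio_mem (hF : delta a b 0 ∈ F) : xRatio a b ∈ F := by
  rw [xRatio_eq ha hb]
  aesop

theorem root_seven_mem (haF : a ∈ F) (hF : delta a b 0 ∈ F) : b ∈ F := by
  have hu : xRatio a b ∈ F := xRatio_mem ha hb hF
  have hu₄ : xRatio a (b ^ 4) ∈ F := by
    refine xRatio_mem ha (hb.pow_of_coprime 4 (by norm_num)) ?_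
    rw [delta_pow_four (one_add_add_sq_eq_zero ha) (sum_pow_eq_zero hb)]
    exact mul_mem hF (pow_mem hu 3)
  rw [← pow_mem_iff_mem hb (n := 2) (by norm_num), root_seven_sq_eq_div ha hb]
  aesop

theorem root_three_mem (hbF : b ∈ F) (hF : delta a b 0 ∈ F) : a ∈ F := by
  have hu : xRatio a b ∈ F := xRatio_mem ha hb hF
  have h7 : (7 : L) ≠ 0 := (hb.neZero' (n := 7)).out
  rw [eq_div_of_mul_eq h7 ((mul_comm a 7).trans (seven_mul_root_three_eq (sum_pow_eq_zero hb)))]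
  aesop

end Subfields

end PrimitiveRoots

section Points

variable {K L : Type*} [Field K] [Field L] [Algebra K L] {c : K} {a b x y : L}

theorem mem_of_pow_three_eq_mul {F : IntermediateField K L} {d : L} (hc : c ≠ 0)
    (hx : x ^ 3 = d * algebraMap K L c) (hxF : x ∈ F) : d ∈ F := by
  rw [eq_div_of_mul_eq ((map_ne_zero _).2 hc) hx.symm]
  exact div_mem (pow_mem hxF 3) (F.algebraMap_mem c)

theorem Y_ne_zero_of_sq_eq (hc : c ≠ 0) (ha : IsPrimitiveRoot a 3) (hb : IsPrimitiveRoot b 7)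
    (hy : y ^ 2 = (delta a b 0 + 1) * algebraMap K L c) : y ≠ 0 := by
  rintro rfl
  exact mul_ne_zero (delta_add_one_ne_zero ha hb) ((map_ne_zero (algebraMap K L)).2 hc)
    (by rw [← hy, zero_pow two_ne_zero])

variable [NeZero (2 : L)]

theorem X_ne_zero_of_pow_three_eq (hc : c ≠ 0) (ha : IsPrimitiveRoot a 3) (hb : IsPrimitiveRoot b 7)
    (hx : x ^ 3 = delta a b 0 * algebraMap K L c) : x ≠ 0 := by
  rintro rfl
  exact mul_ne_zero (delta_ne_zero ha hb) ((map_ne_zero (algebraMap K L)).2 hc)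
    (by rw [← hx, zero_pow three_ne_zero])

theorem adjoin_root_three_eq_adjoin_root_seven (hc : c ≠ 0) (ha : IsPrimitiveRoot a 3)
    (hb : IsPrimitiveRoot b 7) {n : ℕ} (hn : n.Coprime 7)
    (hx : x ^ 3 = delta a (b ^ n) 0 * algebraMap K L c) :
    IntermediateField.adjoin K {x, a, y} = IntermediateField.adjoin K {x, b, y} := by
  have hbn : IsPrimitiveRoot (b ^ n) 7 := hb.pow_of_coprime n hn
  have mem_adjoin {S : Set L} {z : L} (hz : z ∈ S) : z ∈ IntermediateField.adjoin K S :=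
    IntermediateField.subset_adjoin K S hz
  have delta_mem (z : L) : delta a (b ^ n) 0 ∈ IntermediateField.adjoin K {x, z, y} :=
    mem_of_pow_three_eq_mul hc hx (mem_adjoin (.inl rfl))
  apply le_antisymm <;> rw [IntermediateField.adjoin_le_iff] <;> rintro z (rfl | rfl | rfl)
  · exact mem_adjoin (.inl rfl)
  · exact root_three_mem ha hbn (pow_mem (mem_adjoin (.inr (.inl rfl))) n) (delta_mem b)
  · exact mem_adjoin (.inr (.inr rfl))
  · exact mem_adjoin (.inl rfl)
  · exact (pow_mem_iff_mem hb hn).1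
      (root_seven_mem ha hbn (mem_adjoin (.inr (.inl rfl))) (delta_mem a))
  · exact mem_adjoin (.inr (.inr rfl))

variable [DecidableEq L] {h : ((curve c).baseChange L).toAffine.Nonsingular x y}
  (hc : c ≠ 0) (ha : IsPrimitiveRoot a 3) (hb : IsPrimitiveRoot b 7)
  (hx : x ^ 3 = delta a b 0 * algebraMap K L c)

include hc ha hb hx

theorem exists_two_nsmul_eq_some_mul :
    ∃ h', (2 • .some x y h : PointsOver (curve c) L) =
      .some (x * xRatio a b) (y * yRatio a b) h' := by
  have hy : y ^ 2 = (delta a b 0 + 1) * algebraMap K L c := by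
    rw [equation_curve_iff.1 h.1, hx]
    ring
  have hy0 : y ≠ 0 := Y_ne_zero_of_sq_eq hc ha hb hy
  have hu := four_mul_delta_add_one_mul_xRatio (one_add_add_sq_eq_zero ha) (sum_pow_eq_zero hb)
  have hv := eight_mul_delta_add_one_sq_mul_yRatio (one_add_add_sq_eq_zero ha) (sum_pow_eq_zero hb)
  obtain ⟨x₂, y₂, h₂, hP, hx₂, hy₂⟩ := exists_two_nsmul_eq_some h hy0
  have h2 : (2 : L) ≠ 0 := two_ne_zero
  have hX : x₂ = x * xRatio a b := by
    refine mul_left_cancel₀ (mul_ne_zero (pow_ne_zero 2 h2) (pow_ne_zero 2 hy0)) ?_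
    linear_combination hx₂ + x * hx - 4 * x * xRatio a b * hy - x * algebraMap K L c * hu
  have hY : y₂ = y * yRatio a b := by
    refine mul_left_cancel₀ (mul_ne_zero (pow_ne_zero 3 h2) (pow_ne_zero 3 hy0)) ?_
    linear_combination hy₂ + (x ^ 3 + (delta a b 0 + 20) * algebraMap K L c) * hx
      - 8 * yRatio a b * (y ^ 2 + (delta a b 0 + 1) * algebraMap K L c) * hy
      - algebraMap K L c ^ 2 * hv
  subst hX hY
  exact ⟨h₂, hP⟩

theorem exists_two_pow_nsmul_eq_some_mul (n : ℕ) :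
    ∃ h', (2 ^ n • .some x y h : PointsOver (curve c) L) =
      .some (x * ∏ k ∈ Finset.range n, xRatio a (b ^ 4 ^ k))
        (y * ∏ k ∈ Finset.range n, yRatio a (b ^ 4 ^ k)) h' := by
  induction n with
  | zero => simpa using h
  | succ n ih =>
    obtain ⟨h', hn⟩ := ih
    have hxn : (x * ∏ k ∈ Finset.range n, xRatio a (b ^ 4 ^ k)) ^ 3 =
        delta a (b ^ 4 ^ n) 0 * algebraMap K L c := by
      rw [mul_pow, hx, delta_pow_four_pow ha hb]
      ring
    simp only [Finset.prod_range_succ, ← mul_assoc, pow_succ 2, mul_nsmul, hn]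
    exact exists_two_nsmul_eq_some_mul hc ha (isPrimitiveRoot_pow_four_pow hb n) hxn

theorem seven_nsmul_some : (7 • .some x y h : PointsOver (curve c) L) = 0 := by
  obtain ⟨_, h8⟩ := exists_two_pow_nsmul_eq_some_mul (h := h) hc ha hb hx 3
  simp only [prod_xRatio (one_add_add_sq_eq_zero ha) (sum_pow_eq_zero hb),
    prod_yRatio (one_add_add_sq_eq_zero ha) (sum_pow_eq_zero hb), mul_one] at h8
  rwa [(by norm_num : 2 ^ 3 = 7 + 1), succ_nsmul, add_eq_right] at h8

theorem cm_some_ne_zsmul (k : ℤ) :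
    cm c a ha.pow_eq_one (.some x y h) ≠ k • (.some x y h : PointsOver (curve c) L) := by
  intro hk
  rcases zsmul_eq_zero_or_eq_two_pow_nsmul_or_eq_neg
    (seven_nsmul_some (h := h) hc ha hb hx) k with h0 | ⟨n, hn, hkn⟩
  · exact Affine.Point.some_ne_zero _ (hk.trans h0)
  obtain ⟨h', hPn⟩ := exists_two_pow_nsmul_eq_some_mul (h := h) hc ha hb hx n
  rw [← hk, hPn] at hkn
  have hX := (Affine.Point.X_eq_iff (h₁ := nonsingular_mul ha.pow_eq_one h)).2 hkn
  have haX : a = ∏ k ∈ Finset.range n, xRatio a (b ^ 4 ^ k) :=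
    mul_left_cancel₀ (X_ne_zero_of_pow_three_eq hc ha hb hx) ((mul_comm x a).trans hX)
  have hb_pow : b ^ 4 ^ n = b := by
    refine eq_of_delta_eq ha (isPrimitiveRoot_pow_four_pow hb n) hb ?_
    rw [delta_pow_four_pow ha hb, ← haX, ha.pow_eq_one, mul_one]
  obtain rfl : n = 0 := eq_zero_of_pow_four_pow_eq hb hn hb_pow
  exact ha.ne_one (by norm_num) haX

theorem seven_nsmul_cm_some :
    7 • cm c a ha.pow_eq_one (.some x y h : PointsOver (curve c) L) = 0 :=
  seven_nsmul_some hc ha hb (by rw [mul_pow, ha.pow_eq_one, one_mul, hx])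

theorem dvd_and_dvd_of_zsmul_add_zsmul_cm_eq_zero {m n : ℤ}
    (hmn : m • (.some x y h : PointsOver (curve c) L) +
      n • cm c a ha.pow_eq_one (.some x y h) = 0) : (7 : ℤ) ∣ m ∧ (7 : ℤ) ∣ n := by
  have : Fact (Nat.Prime 7) := ⟨by norm_num⟩
  exact dvd_and_dvd_of_zsmul_add_zsmul_eq_zero (seven_nsmul_some hc ha hb hx)
    (seven_nsmul_cm_some hc ha hb hx) (Affine.Point.some_ne_zero h)
    (cm_some_ne_zsmul hc ha hb hx) hmn

theorem seven_nsmul_eq_zero_iff {T : PointsOver (curve c) L} :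
    7 • T = 0 ↔ ∃ m n : ℤ, T = m • .some x y h + n • cm c a ha.pow_eq_one (.some x y h) := by
  have hP : 7 • (.some x y h : PointsOver (curve c) L) = 0 := seven_nsmul_some hc ha hb hx
  have hQ := seven_nsmul_cm_some (h := h) hc ha hb hx
  constructor
  · exact exists_eq_zsmul_add_zsmul_of_encard_le hP hQ
      (fun m n ↦ dvd_and_dvd_of_zsmul_add_zsmul_cm_eq_zero hc ha hb hx)
      (encard_seven_torsion_le (hb.neZero' (n := 7)).out)
  · rintro ⟨m, n, rfl⟩
    rw [nsmul_add, smul_comm, smul_comm 7 n, hP, hQ, smul_zero, smul_zero, add_zero]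

theorem divisionField_seven_eq_adjoin (h : ((curve c).baseChange L).toAffine.Nonsingular x y) :
    divisionField (curve c) L 7 = IntermediateField.adjoin K {x, a, y} := by
  apply le_antisymm
  · have mem_adjoin {z : L} (hz : z ∈ ({x, a, y} : Set L)) :
        z ∈ IntermediateField.adjoin K {x, a, y} := IntermediateField.subset_adjoin K _ hz
    have hxF := mem_adjoin (.inl rfl)
    have haF := mem_adjoin (.inr (.inl rfl))
    have hyF := mem_adjoin (.inr (.inr rfl))
    rw [divisionField_le_iff]
    intro T hT
    obtain ⟨m, n, rfl⟩ := (seven_nsmul_eq_zero_iff (h := h) hc ha hb hx).1 hT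
    exact add_mem (zsmul_mem (some_mem_range_map_val_iff.2 ⟨hxF, hyF⟩) m)
      (zsmul_mem (some_mem_range_map_val_iff.2 ⟨mul_mem haF hxF, hyF⟩) n)
  · obtain ⟨hxF, hyF⟩ := X_mem_and_Y_mem_divisionField (seven_nsmul_some (h := h) hc ha hb hx)
    have haxF : a * x ∈ divisionField (curve c) L 7 :=
      (X_mem_and_Y_mem_divisionField (seven_nsmul_cm_some (h := h) hc ha hb hx)).1
    rw [IntermediateField.adjoin_le_iff]
    rintro z (rfl | rfl | rfl)
    · exact hxF
    · exact mul_div_cancel_right₀ z (X_ne_zero_of_pow_three_eq hc ha hb hx) ▸ div_mem haxF hxF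
    · exact hyF

end Points

end DivisionField

theorem theorem4_general {K : Type*} [Field K]
    {L : Type*} [Field L] [DecidableEq L] [Algebra K L] (h2 : (2 : L) ≠ 0)
    (c : K) (hc : c ≠ 0)
    (ζ₃ ζ₇ : L) (hζ₃ : IsPrimitiveRoot ζ₃ 3) (hζ₇ : IsPrimitiveRoot ζ₇ 7)
    (j : Fin 6) (x y : L)
    (hx : x ^ 3 = DivisionField.delta ζ₃ ζ₇ j * algebraMap K L c)
    (hy : y ^ 2 = (DivisionField.delta ζ₃ ζ₇ j + 1) * algebraMap K L c) :
    DivisionField.divisionField (DivisionField.curve c) L 7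
        = IntermediateField.adjoin K {x, ζ₃, y} ∧
    DivisionField.divisionField (DivisionField.curve c) L 7
        = IntermediateField.adjoin K {x, ζ₇, y} ∧
    (((DivisionField.curve c).baseChange L).preΨ' 7).eval x = 0 ∧
    ∃ h : ((DivisionField.curve c).baseChange L).toAffine.Nonsingular x y,
      ∀ P : DivisionField.PointsOver (DivisionField.curve c) L,
        P = WeierstrassCurve.Affine.Point.some x y h →
        (∀ a b : ℤ, a • P + b • DivisionField.cm c ζ₃ hζ₃.pow_eq_one P = 0 →
          (7 : ℤ) ∣ a ∧ (7 : ℤ) ∣ b) ∧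
        (∀ T : DivisionField.PointsOver (DivisionField.curve c) L,
          7 • T = 0 ↔
            ∃ a b : ℤ, T = a • P + b • DivisionField.cm c ζ₃ hζ₃.pow_eq_one P) := by
  open DivisionField in
  have : NeZero (2 : L) := ⟨h2⟩
  obtain ⟨n, hn, hδ⟩ := exists_coprime_delta_eq (sum_pow_eq_zero hζ₇) j
  rw [hδ] at hx hy
  have hb : IsPrimitiveRoot (ζ₇ ^ n) 7 := hζ₇.pow_of_coprime n hn
  have h : ((curve c).baseChange L).toAffine.Nonsingular x y :=
    nonsingular_curve_of_Y_ne_zero (by rw [hy, hx]; ring) (Y_ne_zero_of_sq_eq hc hζ₃ hb hy)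
  have hfield := divisionField_seven_eq_adjoin hc hζ₃ hb hx h
  refine ⟨hfield, hfield.trans (adjoin_root_three_eq_adjoin_root_seven hc hζ₃ hζ₇ hn hx),
    eval_preΨ'_seven_eq_zero (seven_nsmul_some (h := h) hc hζ₃ hb hx), h, ?_⟩
  rintro P rfl
  exact ⟨fun _ _ ↦ dvd_and_dvd_of_zsmul_add_zsmul_cm_eq_zero hc hζ₃ hb hx,
    fun _ ↦ seven_nsmul_eq_zero_iff hc hζ₃ hb hx⟩

theorem theorem4 {K : Type*} [Field K] [NumberField K]
    {L : Type*} [Field L] [DecidableEq L] [Algebra K L] [IsAlgClosure K L]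
    (c : K) (hc : c ≠ 0)
    (ζ₃ ζ₇ : L) (hζ₃ : IsPrimitiveRoot ζ₃ 3) (hζ₇ : IsPrimitiveRoot ζ₇ 7)
    (j : Fin 6) (x y : L)
    (hx : x ^ 3 = DivisionField.delta ζ₃ ζ₇ j * algebraMap K L c)
    (hy : y ^ 2 = (DivisionField.delta ζ₃ ζ₇ j + 1) * algebraMap K L c) :
    DivisionField.divisionField (DivisionField.curve c) L 7
        = IntermediateField.adjoin K {x, ζ₃, y} ∧
    DivisionField.divisionField (DivisionField.curve c) L 7
        = IntermediateField.adjoin K {x, ζ₇, y} ∧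
    (((DivisionField.curve c).baseChange L).preΨ' 7).eval x = 0 ∧
    ∃ h : ((DivisionField.curve c).baseChange L).toAffine.Nonsingular x y,
      ∀ P : DivisionField.PointsOver (DivisionField.curve c) L,
        P = WeierstrassCurve.Affine.Point.some x y h →
        (∀ a b : ℤ, a • P + b • DivisionField.cm c ζ₃ hζ₃.pow_eq_one P = 0 →
          (7 : ℤ) ∣ a ∧ (7 : ℤ) ∣ b) ∧
        (∀ T : DivisionField.PointsOver (DivisionField.curve c) L,
          7 • T = 0 ↔
            ∃ a b : ℤ, T = a • P + b • DivisionField.cm c ζ₃ hζ₃.pow_eq_one P) := by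
  have : CharZero L := charZero_of_injective_algebraMap (algebraMap K L).injective
  exact theorem4_general two_ne_zero c hc ζ₃ ζ₇ hζ₃ hζ₇ j x y hx hy
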